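/- Let $\mathcal C$ be a small closed symmetric monoidal category, and let $(K_i\colon J_i\to\mathcal C)_{i\in I}$ and $(K'_i\colon J'_i\to\mathcal C)_{i\in I'}$ be small families of diagrams in $\mathcal C$ whose shapes $J_i$, $J'_i$ are small categories with at least one object, such that each $K_i$ has a limit in $\mathcal C$ and each $K'_i$ has a colimit in $\mathcal C$. Then there exist a (locally small) $\ast$-autonomous category $\mathcal D$, that is, a closed symmetric monoidal category with an object $\bot$ such that the canonical map $A\to (A\multimap\bot)\multimap\bot$ is an isomorphism for every object $A$ of $\mathcal D$, and a fully faithful functor $F\colon\mathcal C\to\mathcal D$ such that 1. $F$ is strong symmetric monoidal; 2. $F$ is closed, i.e. for all objects $A,B$ of $\mathcal C$ the canonical map $F(A\multimap B)\to F(A)\multimap F(B)$ is an isomorphism; 3. $F$ preserves the limit of each $K_i$ and the colimit of each $K'_i$. -/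

import Mathlib

namespace ClosedSMC

open CategoryTheory MonoidalCategory

universe v₁ v₂ u₁ u₂

/-- In a closed symmetric monoidal category, with internal hom `[A, -]` right adjoint to `A ⊗ -`,
the canonical map `A ⟶ [[A, b], b]`: the transpose of
`[A, b] ⊗ A ≅ A ⊗ [A, b] ⟶ b`, the symmetry followed by evaluation. -/
def toDoubleDual {D : Type u₁} [Category.{v₁} D] [MonoidalCategory D] [SymmetricCategory D]
    [MonoidalClosed D] (b A : D) : A ⟶ (ihom ((ihom A).obj b)).obj b :=
  MonoidalClosed.curry ((β_ ((ihom A).obj b) A).hom ≫ (ihom.ev A).app b)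

/-- A `∗`-autonomous category: a closed symmetric monoidal category with a dualizing object `⊥`,
that is, an object for which every canonical map `A ⟶ [[A, ⊥], ⊥]` is an isomorphism. -/
class StarAutonomous (D : Type u₁) [Category.{v₁} D] [MonoidalCategory D] [SymmetricCategory D]
    [MonoidalClosed D] where
  /-- the dualizing object -/
  dualizing : D
  isIso_toDoubleDual : ∀ A : D, IsIso (toDoubleDual dualizing A)

/-- For a (lax) monoidal functor `F` between closed monoidal categories, the canonical map
`F [A, B] ⟶ [F A, F B]`: the transpose of `F A ⊗ F [A, B] ⟶ F (A ⊗ [A, B]) ⟶ F B`. -/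
def ihomComparison {C : Type u₁} [Category.{v₁} C] [MonoidalCategory C] [MonoidalClosed C]
    {D : Type u₂} [Category.{v₂} D] [MonoidalCategory D] [MonoidalClosed D]
    (F : C ⥤ D) [F.LaxMonoidal] (A B : C) :
    F.obj ((ihom A).obj B) ⟶ (ihom (F.obj A)).obj (F.obj B) :=
  MonoidalClosed.curry (Functor.LaxMonoidal.μ F A ((ihom A).obj B) ≫ F.map ((ihom.ev A).app B))

/-- A monoidal functor between closed monoidal categories is closed if it preserves internal homs:
all the canonical maps `F [A, B] ⟶ [F A, F B]` are isomorphisms. -/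
def PreservesInternalHom {C : Type u₁} [Category.{v₁} C] [MonoidalCategory C] [MonoidalClosed C]
    {D : Type u₂} [Category.{v₂} D] [MonoidalCategory D] [MonoidalClosed D]
    (F : C ⥤ D) [F.LaxMonoidal] : Prop :=
  ∀ A B : C, IsIso (ihomComparison F A B)

end ClosedSMC

universe w w₁ w₂ v u

open CategoryTheory CategoryTheory.Limits

/-!
A `∗`-autonomous category `D` containing `C` can be built by adjoining formal duals and two bounds.
Its objects are the objects `A` of `C` ("positive"), formal duals `B*` of objects of `C`
("negative"), an initial object `0` and a terminal object `⊤`. The full subcategory of positive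
objects is `C`, that of negative objects is `Cᵒᵖ`, and there are no morphisms between a positive and
a negative object, in either direction, nor from `⊤` to anything but `⊤`, nor to `0` from anything
but `0`. The tensor product extends that of `C` by
`A ⊗ B* = [A, B]*`, `A* ⊗ B* = ⊤`, `0 ⊗ X = 0`, and `⊤ ⊗ X = ⊤` for `X ≠ 0`.
The dualizing object is `⊥ = 𝟙*`, and duality exchanges `A` with `A*` and `0` with `⊤`.

Coherence. A diagram starting at `0` or ending at `⊤` commutes for trivial reasons, so only diagrams
with at most one negative factor matter. To make these easy, the negative objects are encoded not as
objects `B` of `C` but as representable presheaves `T ≅ C(-, B)`; then `[A, B]*` can be taken to be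
the presheaf `T(A ⊗ -)` or, isomorphically, `T(- ⊗ A)`. With the first choice for `T ⊗ A` and the
second for `A ⊗ T`, all structural morphisms are images under `T` of structural morphisms of `C`,
and the coherence laws reduce to those of `C`.

Duality. Each object `X` has a companion `X'` with a pairing `X ⊗ X' ⟶ ⊥` that is universal in both
variables (`exists_isDualPairing`); for `A` and `C(-, A)` this is the Yoneda lemma. In any symmetric
monoidal category such pairings give internal homs `[X, Z] = (X ⊗ Z')'` (`monoidalClosedOfDual`)
for which the map from an object to its double dual is invertible (`isIso_toDoubleDual`).

Preservation. The inclusion of `C` is strict monoidal. A morphism from a negative object or `⊤` to a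
positive object does not exist, and one from `0` is unique, so universal properties of the form
"maps into a positive object" only need to be tested on positive objects. This shows that internal
homs are preserved (`preservesInternalHom_incl`), and also every limit of a nonempty diagram
(`preservesLimit_incl`): a cone over it with a negative vertex or with vertex `⊤` would have a leg.
For the empty diagram this fails, since a terminal object of `C` is not terminal in `D`. Colimits
are dual.
-/

namespace StarEnvelope

open CategoryTheory CategoryTheory.Limits MonoidalCategory Opposite

universe t v₀ u₀

/-! ### Detecting isomorphisms, and presheaves applied to commuting diagrams -/

section Category

variable {C : Type u₀} [Category.{v₀} C]

theorem bijective_of_eq_equiv {α β : Type*} {f : α → β} (e : α ≃ β) (h : ∀ a, f a = e a) :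
    Function.Bijective f :=
  (funext h : f = e) ▸ e.bijective

theorem isIso_of_yoneda_bijective {X Y : C} (f : X ⟶ Y)
    (h : ∀ W : C, Function.Bijective (fun g : W ⟶ X => g ≫ f)) : IsIso f := by
  obtain ⟨g, hg⟩ := (h Y).2 (𝟙 Y)
  exact ⟨g, (h X).1 (by simpa using congrArg (f ≫ ·) hg), hg⟩

theorem map_op_comm (T : Cᵒᵖ ⥤ Type v₀) {W X Y Z : C} {f : W ⟶ X} {g : X ⟶ Z} {h : W ⟶ Y}
    {k : Y ⟶ Z} (w : f ≫ g = h ≫ k) :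
    T.map g.op ≫ T.map f.op = T.map k.op ≫ T.map h.op := by
  rw [← T.map_comp, ← T.map_comp, ← op_comp, ← op_comp, w]

theorem map_op_comp₂ (T : Cᵒᵖ ⥤ Type v₀) {X Y Z : C} {f : X ⟶ Y} {g : Y ⟶ Z} {h : X ⟶ Z}
    (w : f ≫ g = h) : T.map g.op ≫ T.map f.op = T.map h.op := by
  rw [← T.map_comp, ← op_comp, w]

theorem map_op_comp₃ (T : Cᵒᵖ ⥤ Type v₀) {V W X Y Z : C} {f : V ⟶ W} {g : W ⟶ X} {h : X ⟶ Z}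
    {k : V ⟶ Y} {l : Y ⟶ Z} (w : f ≫ g ≫ h = k ≫ l) :
    (T.map h.op ≫ T.map g.op) ≫ T.map f.op = T.map l.op ≫ T.map k.op := by
  rw [Category.assoc, ← T.map_comp, ← T.map_comp, ← T.map_comp, ← op_comp, ← op_comp, ← op_comp,
    Category.assoc, w]

theorem map_op_comp₃₃ (T : Cᵒᵖ ⥤ Type v₀) {V W X Y Y' Z : C} {f : V ⟶ W} {g : W ⟶ X} {h : X ⟶ Z}
    {k : V ⟶ Y} {l : Y ⟶ Y'} {m : Y' ⟶ Z} (w : f ≫ g ≫ h = k ≫ l ≫ m) :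
    (T.map h.op ≫ T.map g.op) ≫ T.map f.op = (T.map m.op ≫ T.map l.op) ≫ T.map k.op := by
  rw [map_op_comp₃ T w, op_comp, T.map_comp]

end Category

theorem uncurry_bijective {D : Type u₀} [Category.{v₀} D] [MonoidalCategory D] [MonoidalClosed D]
    (X Z Y : D) :
    Function.Bijective (MonoidalClosed.uncurry : (Y ⟶ (ihom X).obj Z) → (X ⊗ Y ⟶ Z)) :=
  ((ihom.adjunction X).homEquiv Y Z).symm.bijective

/-! ### Universal pairings in a symmetric monoidal category -/

section Dual

variable {D : Type u₀} [Category.{v₀} D] [MonoidalCategory D]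

/-- A pairing `p : X ⊗ X' ⟶ b` that is universal in both variables: it exhibits `X'` as the internal
hom from `X` to `b` and, up to the symmetry, `X` as the internal hom from `X'` to `b`. -/
structure IsDualPairing {b X X' : D} (p : X ⊗ X' ⟶ b) : Prop where
  right : ∀ Y : D, Function.Bijective (fun f : Y ⟶ X' => X ◁ f ≫ p)
  left : ∀ Y : D, Function.Bijective (fun f : Y ⟶ X => f ▷ X' ≫ p)

theorem IsDualPairing.ofIso {b X X' X'' : D} {p : X ⊗ X' ⟶ b} (hp : IsDualPairing p)
    (e : X'' ≅ X) : IsDualPairing (e.hom ▷ X' ≫ p) where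
  right Y := by
    convert (((whiskerRightIso e Y).symm.homFromEquiv (Z := b)).bijective.comp (hp.right Y))
      using 2 with f
    simp [whisker_exchange_assoc]
  left Y := by
    convert (hp.left Y).comp (e.homToEquiv (Z := Y)).bijective using 2 with f
    simp

/-- The bijection between morphisms into `X'` and pairings with `X`. -/
noncomputable def IsDualPairing.homEquiv {b X X' : D} {p : X ⊗ X' ⟶ b} (hp : IsDualPairing p)
    (Y : D) : (Y ⟶ X') ≃ (X ⊗ Y ⟶ b) :=
  Equiv.ofBijective _ (hp.right Y)

/-- The bijection between morphisms into `X` and pairings with `X'`. -/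
noncomputable def IsDualPairing.homEquivLeft {b X X' : D} {p : X ⊗ X' ⟶ b} (hp : IsDualPairing p)
    (Y : D) : (Y ⟶ X) ≃ (Y ⊗ X' ⟶ b) :=
  Equiv.ofBijective _ (hp.left Y)

variable [SymmetricCategory D]

theorem IsDualPairing.symm {b X X' : D} {p : X ⊗ X' ⟶ b} (hp : IsDualPairing p) :
    IsDualPairing ((β_ X' X).hom ≫ p) where
  right Y := by
    convert (((β_ X' Y).symm.homFromEquiv (Z := b)).bijective.comp (hp.left Y)) using 2 with f
    simp
  left Y := by
    convert (((β_ Y X).symm.homFromEquiv (Z := b)).bijective.comp (hp.right Y)) using 2 with f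
    simp

variable {b : D} {d : D → D} {p : ∀ X, X ⊗ d X ⟶ b}

/-- If every object `X` has a dual `d X` with respect to `b`, then `d (X ⊗ d Z)` has the universal
property of the internal hom from `X` to `Z`: morphisms `X ⊗ Y ⟶ Z` and `Y ⟶ d (X ⊗ d Z)` both
amount to morphisms `X ⊗ Y ⊗ d Z ⟶ b`. -/
noncomputable def tensorHomEquiv (hp : ∀ X, IsDualPairing (p X)) (X Y Z : D) :
    (X ⊗ Y ⟶ Z) ≃ (Y ⟶ d (X ⊗ d Z)) :=
  ((hp Z).homEquivLeft (X ⊗ Y)).trans <|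
    ((α_ X (d Z) Y ≪≫ whiskerLeftIso X (β_ (d Z) Y) ≪≫ (α_ X Y (d Z)).symm).symm.homFromEquiv
      (Z := b)).trans ((hp (X ⊗ d Z)).homEquiv Y).symm

theorem tensorHomEquiv_naturality (hp : ∀ X, IsDualPairing (p X)) (X : D) {Y Y' : D} (Z : D)
    (f : Y' ⟶ Y) (g : X ⊗ Y ⟶ Z) :
    tensorHomEquiv hp X Y' Z (X ◁ f ≫ g) = f ≫ tensorHomEquiv hp X Y Z g := by
  apply ((hp (X ⊗ d Z)).homEquiv Y').injective
  have h : (hp (X ⊗ d Z)).homEquiv Y' (f ≫ tensorHomEquiv hp X Y Z g) =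
      (X ⊗ d Z) ◁ f ≫ (hp (X ⊗ d Z)).homEquiv Y (tensorHomEquiv hp X Y Z g) := by
    simp [IsDualPairing.homEquiv]
  rw [h]
  simp only [tensorHomEquiv, IsDualPairing.homEquivLeft, Equiv.trans_apply, Equiv.apply_symm_apply,
    Equiv.ofBijective_apply]
  simp [-whiskerLeft_comp, ← whiskerLeft_comp_assoc]

/-- The closed structure given by duals: the internal hom from `X` to `Z` is `d (X ⊗ d Z)`. -/
noncomputable abbrev monoidalClosedOfDual (hp : ∀ X, IsDualPairing (p X)) : MonoidalClosed D where
  closed X :=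
    { rightAdj := Adjunction.rightAdjointOfEquiv (F := tensorLeft X)
        (fun Y Z => tensorHomEquiv hp X Y Z)
        (fun _ _ Z f g => tensorHomEquiv_naturality hp X Z f g)
      adj := Adjunction.adjunctionOfEquivRight _ _ }

/-- An object with a dual is isomorphic to its double dual, for any choice of internal homs: the
pairing identifies `X'` with `[X, b]`, and under this identification composition with
`toDoubleDual b X` becomes pairing with `X'`. -/
theorem isIso_toDoubleDual [MonoidalClosed D] {X X' : D} {p : X ⊗ X' ⟶ b}
    (hp : IsDualPairing p) : IsIso (ClosedSMC.toDoubleDual b X) := by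
  -- `X'` and `[X, b]` represent the same functor
  have hj : IsIso (MonoidalClosed.curry p) := isIso_of_yoneda_bijective _ fun W => by
    refine (Function.Bijective.of_comp_iff' (uncurry_bijective X b W) _).1 ?_
    convert hp.right W using 2 with f
    simp [MonoidalClosed.uncurry_natural_left]
  refine isIso_of_yoneda_bijective _ fun W => ?_
  refine (Function.Bijective.of_comp_iff' (uncurry_bijective ((ihom X).obj b) b W) _).1 ?_
  -- replace `[X, b] ⊗ W` by `X' ⊗ W`
  refine (Function.Bijective.of_comp_iff'
    ((whiskerRightIso (asIso (MonoidalClosed.curry p)) W).symm.homFromEquiv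
      (Z := b)).bijective _).1 ?_
  convert ((β_ X' W).symm.homFromEquiv (Z := b)).bijective.comp (hp.left W) using 1
  have h : X ◁ MonoidalClosed.curry p ≫ (ihom.ev X).app b = p := by
    rw [← MonoidalClosed.uncurry_eq, MonoidalClosed.uncurry_curry]
  funext f
  calc MonoidalClosed.curry p ▷ W ≫ MonoidalClosed.uncurry (f ≫ ClosedSMC.toDoubleDual b X)
      = MonoidalClosed.curry p ▷ W ≫ (ihom X).obj b ◁ f ≫
          (β_ ((ihom X).obj b) X).hom ≫ (ihom.ev X).app b := by
        rw [MonoidalClosed.uncurry_natural_left, ClosedSMC.toDoubleDual,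
          MonoidalClosed.uncurry_curry]
    _ = (β_ X' W).hom ≫ f ▷ X' ≫ X ◁ MonoidalClosed.curry p ≫ (ihom.ev X).app b := by
        rw [← whisker_exchange_assoc, BraidedCategory.braiding_naturality_left_assoc,
          BraidedCategory.braiding_naturality_right_assoc]
    _ = (β_ X' W).hom ≫ f ▷ X' ≫ p := by rw [h]

end Dual

/-! ### The underlying category of the envelope -/

section Category

variable (C : Type u₀) [Category.{v₀} C]

/-- The objects of the envelope of `C`: an initial object, a terminal object, the objects of `C`,
and their formal duals. The formal dual of `B` is encoded by a presheaf representable by `B`; neither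
`B` nor the representation is part of the data. The parameter `t` only raises the universe. -/
inductive Env : Type (max u₀ v₀ t + 1)
  | zero : Env
  | top : Env
  | pos (A : C) : Env
  | neg (T : Cᵒᵖ ⥤ Type v₀) (hT : T.IsRepresentable) : Env

variable {C}

namespace Env

/-- Morphisms in the envelope: those of `C` between positive objects, those of `Cᵒᵖ` (in the form of
natural transformations in the opposite direction) between negative objects, a unique morphism from
`zero` to any object and from any object to `top`, and no others. -/
def Hom : Env.{t} C → Env.{t} C → Type (max u₀ v₀ t)
  | zero, _ => PUnit
  | top, zero => PEmpty
  | top, top => PUnit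
  | top, pos _ => PEmpty
  | top, neg _ _ => PEmpty
  | pos _, zero => PEmpty
  | pos _, top => PUnit
  | pos A, pos B => ULift.{max u₀ t} (A ⟶ B)
  | pos _, neg _ _ => PEmpty
  | neg _ _, zero => PEmpty
  | neg _ _, top => PUnit
  | neg _ _, pos _ => PEmpty
  | neg S _, neg T _ => ULift.{t} (T ⟶ S)

namespace Hom

/-- Identity morphisms of the envelope. -/
def id : (X : Env.{t} C) → Hom X X
  | zero => ⟨⟩
  | top => ⟨⟩
  | pos A => ⟨𝟙 A⟩
  | neg T _ => ⟨𝟙 T⟩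

/-- Composition in the envelope. -/
def comp : {X Y Z : Env.{t} C} → Hom X Y → Hom Y Z → Hom X Z
  | zero, _, _, _, _ => ⟨⟩
  | top, top, _, _, g => g
  | pos _, top, top, _, _ => ⟨⟩
  | pos _, pos _, top, _, _ => ⟨⟩
  | pos _, pos _, pos _, f, g => ⟨f.down ≫ g.down⟩
  | neg _ _, top, top, _, _ => ⟨⟩
  | neg _ _, neg _ _, top, _, _ => ⟨⟩
  | neg _ _, neg _ _, neg _ _, f, g => ⟨g.down ≫ f.down⟩

end Hom

instance : Category.{max u₀ v₀ t} (Env.{t} C) where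
  Hom := Hom
  id := Hom.id
  comp := Hom.comp
  id_comp {X Y} f := by
    cases X <;> cases Y <;> first | exact PEmpty.elim f | rfl |
      exact congrArg ULift.up (Category.id_comp _)
  comp_id {X Y} f := by
    cases X <;> cases Y <;> first | exact PEmpty.elim f | rfl |
      exact congrArg ULift.up (Category.comp_id _)
  assoc {W X Y Z} f g h := by
    cases W <;> cases X <;> first | exact PEmpty.elim f | cases Y <;>
      first | exact PEmpty.elim g | cases Z <;> first | exact PEmpty.elim h | rfl |
        exact congrArg ULift.up (Category.assoc _ _ _)

theorem eq_of_zero {X : Env.{t} C} (f g : (zero : Env.{t} C) ⟶ X) : f = g := rfl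

theorem eq_of_top {X : Env.{t} C} (f g : X ⟶ (top : Env.{t} C)) : f = g := by
  cases X <;> rfl

/-- A morphism of `C` as a morphism between positive objects. -/
def posHom {A B : C} (f : A ⟶ B) : (pos A : Env.{t} C) ⟶ pos B := ULift.up f

/-- A natural transformation as a morphism between negative objects, with its direction reversed. -/
def negHom {S T : Cᵒᵖ ⥤ Type v₀} {hS : S.IsRepresentable} {hT : T.IsRepresentable} (φ : T ⟶ S) :
    (neg S hS : Env.{t} C) ⟶ neg T hT := ULift.up φ

theorem negHom_eq {S T : Cᵒᵖ ⥤ Type v₀} {hS : S.IsRepresentable} {hT : T.IsRepresentable}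
    {φ ψ : T ⟶ S} (h : ∀ X, φ.app X = ψ.app X) :
    (negHom φ : (neg S hS : Env.{t} C) ⟶ neg T hT) = negHom ψ :=
  congrArg negHom (NatTrans.ext (funext h))

/-- An isomorphism of `C` as one between positive objects. -/
def posIso {A B : C} (e : A ≅ B) : (pos A : Env.{t} C) ≅ pos B where
  hom := posHom e.hom
  inv := posHom e.inv
  hom_inv_id := congrArg posHom e.hom_inv_id
  inv_hom_id := congrArg posHom e.inv_hom_id

/-- A natural isomorphism as one between negative objects, with its direction reversed. -/
def negIso {S T : Cᵒᵖ ⥤ Type v₀} {hS : S.IsRepresentable} {hT : T.IsRepresentable} (e : T ≅ S) :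
    (neg S hS : Env.{t} C) ≅ neg T hT where
  hom := negHom e.hom
  inv := negHom e.inv
  hom_inv_id := congrArg negHom e.inv_hom_id
  inv_hom_id := congrArg negHom e.hom_inv_id

end Env

end Category

/-! ### The symmetric monoidal structure of the envelope -/

section Monoidal

variable {C : Type u₀} [Category.{v₀} C] [MonoidalCategory C]

/-- The presheaf `T(A ⊗ -)`. For `T = C(-, B)` it is represented by the internal hom from `A` to
`B`. -/
abbrev lAct (A : C) (T : Cᵒᵖ ⥤ Type v₀) : Cᵒᵖ ⥤ Type v₀ := (tensorLeft A).op ⋙ T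

/-- The presheaf `T(- ⊗ A)`. -/
abbrev rAct (A : C) (T : Cᵒᵖ ⥤ Type v₀) : Cᵒᵖ ⥤ Type v₀ := (tensorRight A).op ⋙ T

/-- The action of a morphism of `C` on the presheaves `T(A ⊗ -)`. -/
abbrev lActMap {A B : C} (f : A ⟶ B) (T : Cᵒᵖ ⥤ Type v₀) : lAct B T ⟶ lAct A T where
  app X := T.map (f ▷ X.unop).op
  naturality X Y g := by
    simp [← Functor.map_comp, whisker_exchange]

/-- The action of a morphism of `C` on the presheaves `T(- ⊗ A)`. -/
abbrev rActMap {A B : C} (f : A ⟶ B) (T : Cᵒᵖ ⥤ Type v₀) : rAct B T ⟶ rAct A T where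
  app X := T.map (X.unop ◁ f).op
  naturality X Y g := by
    simp [← Functor.map_comp, whisker_exchange]

/-- The associator, as the commutation of tensoring on the left with tensoring on the right. -/
abbrev tensorLeftRightIso (A B : C) :
    tensorLeft A ⋙ tensorRight B ≅ tensorRight B ⋙ tensorLeft A :=
  NatIso.ofComponents (fun X => α_ A X B)

/-- Isomorphic endofunctors of `C` give isomorphic presheaves by precomposition. -/
abbrev precompIso {F G : C ⥤ C} (e : F ≅ G) (T : Cᵒᵖ ⥤ Type v₀) : G.op ⋙ T ≅ F.op ⋙ T :=
  Functor.isoWhiskerRight (NatIso.op e) T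

theorem isRepresentable_lAct [MonoidalClosed C] (A : C) {T : Cᵒᵖ ⥤ Type v₀}
    (hT : T.IsRepresentable) :
    (lAct A T).IsRepresentable := by
  obtain ⟨B, ⟨e⟩⟩ := hT.has_representation
  exact ⟨(ihom A).obj B, ⟨{
    homEquiv := ((ihom.adjunction A).homEquiv _ _).symm.trans e.homEquiv
    homEquiv_comp := fun f g => by
      rw [Equiv.trans_apply, Adjunction.homEquiv_naturality_left_symm, e.homEquiv_comp]
      rfl }⟩⟩

/-- The isomorphism `T(A ⊗ -) ≅ T(- ⊗ A)` given by the symmetry. -/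
def lActIsoRAct [SymmetricCategory C] (A : C) (T : Cᵒᵖ ⥤ Type v₀) : lAct A T ≅ rAct A T :=
  precompIso (BraidedCategory.tensorLeftIsoTensorRight A).symm T

theorem isRepresentable_rAct [SymmetricCategory C] [MonoidalClosed C] (A : C) {T : Cᵒᵖ ⥤ Type v₀}
    (hT : T.IsRepresentable) :
    (rAct A T).IsRepresentable :=
  have := isRepresentable_lAct A hT
  isRepresentable_of_natIso _ (lActIsoRAct A T)

variable [SymmetricCategory C] [MonoidalClosed C]

namespace Env

/-- The tensor product of objects. A positive object acts on a negative one from either side, by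
tensoring the argument of the presheaf on the opposite side; this makes every instance of the
associator with one negative factor the image of an associator of `C`, with no symmetry involved. -/
def tensorObj : Env.{t} C → Env.{t} C → Env.{t} C
  | zero, _ => zero
  | top, zero => zero
  | top, top => top
  | top, pos _ => top
  | top, neg _ _ => top
  | pos _, zero => zero
  | pos _, top => top
  | pos A, pos B => pos (A ⊗ B)
  | pos A, neg T hT => neg (rAct A T) (isRepresentable_rAct A hT)
  | neg _ _, zero => zero
  | neg _ _, top => top
  | neg T hT, pos A => neg (lAct A T) (isRepresentable_lAct A hT)
  | neg _ _, neg _ _ => top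

/-- Tensoring a morphism with an object on the left. -/
def whiskerLeft : (X : Env.{t} C) → {Y Z : Env.{t} C} → (Y ⟶ Z) →
    (tensorObj X Y ⟶ tensorObj X Z)
  | zero, _, _, _ => PUnit.unit
  | top, zero, _, _ => PUnit.unit
  | top, top, top, _ => PUnit.unit
  | top, pos _, top, _ => PUnit.unit
  | top, pos _, pos _, _ => PUnit.unit
  | top, neg _ _, top, _ => PUnit.unit
  | top, neg _ _, neg _ _, _ => PUnit.unit
  | pos _, zero, _, _ => PUnit.unit
  | pos _, top, top, _ => PUnit.unit
  | pos _, pos _, top, _ => PUnit.unit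
  | pos A, pos _, pos _, f => posHom (A ◁ f.down)
  | pos _, neg _ _, top, _ => PUnit.unit
  | pos A, neg _ _, neg _ _, f => negHom (Functor.whiskerLeft (tensorRight A).op f.down)
  | neg _ _, zero, _, _ => PUnit.unit
  | neg _ _, top, top, _ => PUnit.unit
  | neg _ _, pos _, top, _ => PUnit.unit
  | neg T _, pos _, pos _, f => negHom (lActMap f.down T)
  | neg _ _, neg _ _, top, _ => PUnit.unit
  | neg _ _, neg _ _, neg _ _, _ => PUnit.unit

/-- Tensoring a morphism with an object on the right. -/
def whiskerRight : {X Y : Env.{t} C} → (X ⟶ Y) → (Z : Env.{t} C) →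
    (tensorObj X Z ⟶ tensorObj Y Z)
  | zero, _, _, _ => PUnit.unit
  | top, top, _, _ => 𝟙 _
  | pos _, top, _, zero => PUnit.unit
  | pos _, top, _, top => PUnit.unit
  | pos _, top, _, pos _ => PUnit.unit
  | pos _, top, _, neg _ _ => PUnit.unit
  | pos _, pos _, _, zero => PUnit.unit
  | pos _, pos _, _, top => PUnit.unit
  | pos _, pos _, f, pos A => posHom (f.down ▷ A)
  | pos _, pos _, f, neg T _ => negHom (rActMap f.down T)
  | neg _ _, top, _, zero => PUnit.unit
  | neg _ _, top, _, top => PUnit.unit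
  | neg _ _, top, _, pos _ => PUnit.unit
  | neg _ _, top, _, neg _ _ => PUnit.unit
  | neg _ _, neg _ _, _, zero => PUnit.unit
  | neg _ _, neg _ _, _, top => PUnit.unit
  | neg _ _, neg _ _, f, pos A => negHom (Functor.whiskerLeft (tensorLeft A).op f.down)
  | neg _ _, neg _ _, _, neg _ _ => PUnit.unit

/-- The associator of the envelope. -/
def associator : (X Y Z : Env.{t} C) →
    (tensorObj (tensorObj X Y) Z ≅ tensorObj X (tensorObj Y Z))
  | zero, _, _ => Iso.refl zero
  | top, zero, _ => Iso.refl zero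
  | top, top, zero => Iso.refl zero
  | top, top, top => Iso.refl top
  | top, top, pos _ => Iso.refl top
  | top, top, neg _ _ => Iso.refl top
  | top, pos _, zero => Iso.refl zero
  | top, pos _, top => Iso.refl top
  | top, pos _, pos _ => Iso.refl top
  | top, pos _, neg _ _ => Iso.refl top
  | top, neg _ _, zero => Iso.refl zero
  | top, neg _ _, top => Iso.refl top
  | top, neg _ _, pos _ => Iso.refl top
  | top, neg _ _, neg _ _ => Iso.refl top
  | pos _, zero, _ => Iso.refl zero
  | pos _, top, zero => Iso.refl zero
  | pos _, top, top => Iso.refl top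
  | pos _, top, pos _ => Iso.refl top
  | pos _, top, neg _ _ => Iso.refl top
  | pos _, pos _, zero => Iso.refl zero
  | pos _, pos _, top => Iso.refl top
  | pos A, pos B, pos D => posIso (α_ A B D)
  | pos A, pos B, neg T _ => negIso (precompIso (tensorRightTensor A B) T)
  | pos _, neg _ _, zero => Iso.refl zero
  | pos _, neg _ _, top => Iso.refl top
  | pos A, neg T _, pos B => negIso (precompIso (tensorLeftRightIso B A) T)
  | pos _, neg _ _, neg _ _ => Iso.refl top
  | neg _ _, zero, _ => Iso.refl zero
  | neg _ _, top, zero => Iso.refl zero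
  | neg _ _, top, top => Iso.refl top
  | neg _ _, top, pos _ => Iso.refl top
  | neg _ _, top, neg _ _ => Iso.refl top
  | neg _ _, pos _, zero => Iso.refl zero
  | neg _ _, pos _, top => Iso.refl top
  | neg T _, pos A, pos B => negIso (precompIso (tensorLeftTensor A B).symm T)
  | neg _ _, pos _, neg _ _ => Iso.refl top
  | neg _ _, neg _ _, zero => Iso.refl zero
  | neg _ _, neg _ _, top => Iso.refl top
  | neg _ _, neg _ _, pos _ => Iso.refl top
  | neg _ _, neg _ _, neg _ _ => Iso.refl top

/-- The left unitor; on a presheaf `T` it is the image of the right unitor of `C`, because a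
positive object acts from the left by `T(- ⊗ A)`. -/
def leftUnitor : (X : Env.{t} C) → (tensorObj (pos (𝟙_ C)) X ≅ X)
  | zero => Iso.refl zero
  | top => Iso.refl top
  | pos A => posIso (λ_ A)
  | neg T _ => negIso (precompIso (rightUnitorNatIso C) T)

/-- The right unitor; on a presheaf `T` it is the image of the left unitor of `C`. -/
def rightUnitor : (X : Env.{t} C) → (tensorObj X (pos (𝟙_ C)) ≅ X)
  | zero => Iso.refl zero
  | top => Iso.refl top
  | pos A => posIso (ρ_ A)
  | neg T _ => negIso (precompIso (leftUnitorNatIso C) T)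

/-- The symmetry of the envelope. -/
def braiding : (X Y : Env.{t} C) → (tensorObj X Y ≅ tensorObj Y X)
  | zero, zero => Iso.refl zero
  | zero, top => Iso.refl zero
  | zero, pos _ => Iso.refl zero
  | zero, neg _ _ => Iso.refl zero
  | top, zero => Iso.refl zero
  | top, top => Iso.refl top
  | top, pos _ => Iso.refl top
  | top, neg _ _ => Iso.refl top
  | pos _, zero => Iso.refl zero
  | pos _, top => Iso.refl top
  | pos A, pos B => posIso (β_ A B)
  | pos A, neg T _ => negIso (lActIsoRAct A T)
  | neg _ _, zero => Iso.refl zero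
  | neg _ _, top => Iso.refl top
  | neg T _, pos A => negIso (precompIso (BraidedCategory.tensorLeftIsoTensorRight A) T)
  | neg _ _, neg _ _ => Iso.refl top

instance : MonoidalCategoryStruct (Env.{t} C) where
  tensorObj := tensorObj
  whiskerLeft := whiskerLeft
  whiskerRight := whiskerRight
  tensorUnit := pos (𝟙_ C)
  associator := associator
  leftUnitor := leftUnitor
  rightUnitor := rightUnitor

/-- As for all the monoidal laws below, only the cases without `zero` and `top` and with at most one
negative factor have content. They reduce to identities in `C`, or to naturality of a transformation
with respect to a morphism of `C`. -/
theorem whiskerLeft_id (X Y : Env.{t} C) : X ◁ 𝟙 Y = 𝟙 (X ⊗ Y) := by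
  cases X <;> cases Y <;> first | rfl | skip
  case pos.pos A B => exact congrArg posHom (MonoidalCategory.whiskerLeft_id A B)
  case neg.pos T _ A =>
    refine negHom_eq fun X => ?_
    change T.map (𝟙 A ▷ X.unop).op = 𝟙 _
    rw [MonoidalCategory.id_whiskerRight, op_id, T.map_id]

theorem id_whiskerRight (X Y : Env.{t} C) : 𝟙 X ▷ Y = 𝟙 (X ⊗ Y) := by
  cases X <;> cases Y <;> first | rfl | skip
  case pos.pos A B => exact congrArg posHom (MonoidalCategory.id_whiskerRight A B)
  case pos.neg A T _ =>
    refine negHom_eq fun X => ?_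
    change T.map (X.unop ◁ 𝟙 A).op = 𝟙 _
    rw [MonoidalCategory.whiskerLeft_id, op_id, T.map_id]

theorem whiskerLeft_comp (W : Env.{t} C) {X Y Z : Env.{t} C} (f : X ⟶ Y) (g : Y ⟶ Z) :
    W ◁ (f ≫ g) = W ◁ f ≫ W ◁ g := by
  cases W <;> cases X <;> cases Y <;> first | exact PEmpty.elim f | cases Z <;>
    first | exact PEmpty.elim g | exact eq_of_zero _ _ | exact eq_of_top _ _ | rfl | skip
  case pos.pos.pos.pos A _ _ _ =>
    exact congrArg posHom (MonoidalCategory.whiskerLeft_comp A f.down g.down)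
  case neg.pos.pos.pos T _ _ _ _ =>
    refine negHom_eq fun X => ?_
    change T.map ((f.down ≫ g.down) ▷ X.unop).op =
      T.map (g.down ▷ X.unop).op ≫ T.map (f.down ▷ X.unop).op
    rw [comp_whiskerRight, op_comp, T.map_comp]

theorem comp_whiskerRight {X Y Z : Env.{t} C} (f : X ⟶ Y) (g : Y ⟶ Z) (W : Env.{t} C) :
    (f ≫ g) ▷ W = f ▷ W ≫ g ▷ W := by
  cases W <;> cases X <;> cases Y <;> first | exact PEmpty.elim f | cases Z <;>
    first | exact PEmpty.elim g | exact eq_of_zero _ _ | exact eq_of_top _ _ | rfl | skip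
  case pos.pos.pos.pos A _ _ _ =>
    exact congrArg posHom (MonoidalCategory.comp_whiskerRight f.down g.down A)
  case neg.pos.pos.pos T _ _ _ _ =>
    refine negHom_eq fun X => ?_
    change T.map (X.unop ◁ (f.down ≫ g.down)).op =
      T.map (X.unop ◁ g.down).op ≫ T.map (X.unop ◁ f.down).op
    rw [MonoidalCategory.whiskerLeft_comp, op_comp, T.map_comp]

theorem whisker_exchange {W X Y Z : Env.{t} C} (f : W ⟶ X) (g : Y ⟶ Z) :
    W ◁ g ≫ f ▷ Z = f ▷ Y ≫ X ◁ g := by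
  cases W <;> cases X <;> first | exact PEmpty.elim f | cases Y <;> cases Z <;>
    first | exact PEmpty.elim g | exact eq_of_zero _ _ | exact eq_of_top _ _ | skip
  case pos.pos.pos.pos =>
    exact congrArg posHom (MonoidalCategory.whisker_exchange f.down g.down)
  case pos.pos.neg.neg =>
    exact negHom_eq fun X => g.down.naturality (X.unop ◁ f.down).op
  case neg.neg.pos.pos =>
    exact negHom_eq fun X => (f.down.naturality (g.down ▷ X.unop).op).symm

theorem associator_naturality_left {X X' : Env.{t} C} (f : X ⟶ X') (Y Z : Env.{t} C) :
    (f ▷ Y) ▷ Z ≫ (α_ X' Y Z).hom = (α_ X Y Z).hom ≫ f ▷ (Y ⊗ Z) := by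
  cases X <;> cases X' <;> first | exact PEmpty.elim f | cases Y <;> cases Z <;>
    first | exact eq_of_zero _ _ | exact eq_of_top _ _ | skip
  case pos.pos.pos.pos =>
    exact congrArg posHom (MonoidalCategory.associator_naturality_left f.down _ _)
  case pos.pos.pos.neg A T _ =>
    exact negHom_eq fun X => map_op_comm T <| associator_inv_naturality_middle X.unop f.down A
  case pos.pos.neg.pos T _ A =>
    exact negHom_eq fun X => map_op_comm T <| associator_naturality_right A X.unop f.down
  case neg.neg.pos.pos A B =>
    exact negHom_eq fun X => f.down.naturality (α_ A B X.unop).inv.op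

theorem associator_naturality_middle (X : Env.{t} C) {Y Y' : Env.{t} C} (f : Y ⟶ Y')
    (Z : Env.{t} C) :
    (X ◁ f) ▷ Z ≫ (α_ X Y' Z).hom = (α_ X Y Z).hom ≫ X ◁ (f ▷ Z) := by
  cases Y <;> cases Y' <;> first | exact PEmpty.elim f | cases X <;> cases Z <;>
    first | exact eq_of_zero _ _ | exact eq_of_top _ _ | skip
  case pos.pos.pos.pos =>
    exact congrArg posHom (MonoidalCategory.associator_naturality_middle _ f.down _)
  case pos.pos.pos.neg A T _ =>
    exact negHom_eq fun X => map_op_comm T <| associator_inv_naturality_right X.unop A f.down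
  case pos.pos.neg.pos T _ A =>
    exact negHom_eq fun X => map_op_comm T <| associator_inv_naturality_left f.down A X.unop
  case neg.neg.pos.pos A B =>
    exact negHom_eq fun X => f.down.naturality (α_ B X.unop A).hom.op

theorem associator_naturality_right (X Y : Env.{t} C) {Z Z' : Env.{t} C} (f : Z ⟶ Z') :
    (X ⊗ Y) ◁ f ≫ (α_ X Y Z').hom = (α_ X Y Z).hom ≫ X ◁ (Y ◁ f) := by
  cases Z <;> cases Z' <;> first | exact PEmpty.elim f | cases X <;> cases Y <;>
    first | exact eq_of_zero _ _ | exact eq_of_top _ _ | skip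
  case pos.pos.pos.pos =>
    exact congrArg posHom (MonoidalCategory.associator_naturality_right _ _ f.down)
  case pos.pos.pos.neg A T _ =>
    exact negHom_eq fun X => map_op_comm T <|
      MonoidalCategory.associator_naturality_left f.down X.unop A
  case pos.pos.neg.pos T _ A =>
    exact negHom_eq fun X => map_op_comm T <| associator_inv_naturality_middle A f.down X.unop
  case neg.neg.pos.pos A B =>
    exact negHom_eq fun X => f.down.naturality (α_ X.unop A B).inv.op

instance : MonoidalCategory (Env.{t} C) where
  tensorHom_def _ _ := rfl
  id_tensorHom_id X Y := by
    change 𝟙 X ▷ Y ≫ X ◁ 𝟙 Y = 𝟙 (X ⊗ Y)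
    rw [whiskerLeft_id, id_whiskerRight, Category.comp_id]
  tensorHom_comp_tensorHom {X₁ Y₁ Z₁ X₂ Y₂ Z₂} f₁ f₂ g₁ g₂ := by
    change (f₁ ▷ X₂ ≫ Y₁ ◁ f₂) ≫ g₁ ▷ Y₂ ≫ Z₁ ◁ g₂ = (f₁ ≫ g₁) ▷ X₂ ≫ Z₁ ◁ (f₂ ≫ g₂)
    rw [whiskerLeft_comp, comp_whiskerRight, Category.assoc, Category.assoc,
      ← Category.assoc (Y₁ ◁ f₂), whisker_exchange, Category.assoc]
  whiskerLeft_id := whiskerLeft_id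
  id_whiskerRight := id_whiskerRight
  associator_naturality {X₁ X₂ X₃ Y₁ Y₂ Y₃} f₁ f₂ f₃ := by
    change ((f₁ ▷ X₂ ≫ Y₁ ◁ f₂) ▷ X₃ ≫ (Y₁ ⊗ Y₂) ◁ f₃) ≫ (α_ Y₁ Y₂ Y₃).hom =
      (α_ X₁ X₂ X₃).hom ≫ f₁ ▷ (X₂ ⊗ X₃) ≫ Y₁ ◁ (f₂ ▷ X₃ ≫ Y₂ ◁ f₃)
    rw [comp_whiskerRight, whiskerLeft_comp, Category.assoc, Category.assoc,
      associator_naturality_right, ← Category.assoc ((Y₁ ◁ f₂) ▷ X₃),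
      associator_naturality_middle, ← Category.assoc, ← Category.assoc,
      associator_naturality_left]
    simp only [Category.assoc]
  leftUnitor_naturality {X Y} f := by
    cases X <;> cases Y <;>
      first | exact PEmpty.elim f | exact eq_of_zero _ _ | exact eq_of_top _ _ | skip
    case pos.pos => exact congrArg posHom (MonoidalCategory.leftUnitor_naturality f.down)
    case neg.neg => exact negHom_eq fun X => f.down.naturality (ρ_ X.unop).hom.op
  rightUnitor_naturality {X Y} f := by
    cases X <;> cases Y <;>
      first | exact PEmpty.elim f | exact eq_of_zero _ _ | exact eq_of_top _ _ | skip
    case pos.pos => exact congrArg posHom (MonoidalCategory.rightUnitor_naturality f.down)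
    case neg.neg => exact negHom_eq fun X => f.down.naturality (λ_ X.unop).hom.op
  pentagon W X Y Z := by
    cases W <;> cases X <;> cases Y <;> cases Z <;>
      first | exact eq_of_zero _ _ | exact eq_of_top _ _ | skip
    case pos.pos.pos.pos A B D E =>
      refine congrArg posHom ?_
      exact MonoidalCategory.pentagon A B D E
    case pos.pos.pos.neg A B D T _ =>
      refine negHom_eq fun X => map_op_comp₃ T ?_
      change X.unop ◁ (α_ A B D).hom ≫ (α_ _ _ _).inv ≫ (α_ _ _ _).inv =
        (α_ _ _ _).inv ≫ (α_ _ _ _).inv ▷ D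
      monoidal
    case pos.pos.neg.pos A B T _ D =>
      refine negHom_eq fun X => map_op_comp₃ T ?_
      change (α_ _ A B).inv ≫ (α_ D X.unop A).hom ▷ B ≫ (α_ _ _ _).hom =
        (α_ _ _ _).hom ≫ D ◁ (α_ X.unop A B).inv
      monoidal
    case pos.neg.pos.pos A T _ B D =>
      refine negHom_eq fun X => map_op_comp₃ T ?_
      change (α_ B (D ⊗ X.unop) A).hom ≫ B ◁ (α_ D X.unop A).hom ≫ (α_ _ _ _).inv =
        (α_ B D X.unop).inv ▷ A ≫ (α_ _ _ _).hom
      monoidal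
    case neg.pos.pos.pos T _ A B D =>
      refine negHom_eq fun X => map_op_comp₃ T ?_
      change (α_ A B _).inv ≫ (α_ _ D X.unop).inv ≫ (α_ A B D).hom ▷ X.unop =
        A ◁ (α_ B D X.unop).inv ≫ (α_ _ _ _).inv
      monoidal
  triangle X Y := by
    cases X <;> cases Y <;>
      first | exact eq_of_zero _ _ | exact eq_of_top _ _ | skip
    case pos.pos A B => exact congrArg posHom (MonoidalCategory.triangle A B)
    case pos.neg A T _ =>
      refine negHom_eq fun X => map_op_comp₂ T ?_
      change (α_ _ _ _).inv ≫ (ρ_ _).hom = X.unop ◁ (ρ_ A).hom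
      monoidal
    case neg.pos T _ A =>
      refine negHom_eq fun X => map_op_comp₂ T ?_
      change (α_ _ _ _).inv ≫ (λ_ A).hom ▷ X.unop = (λ_ _).hom
      monoidal

theorem symmetry (X Y : Env.{t} C) : (braiding X Y).hom ≫ (braiding Y X).hom = 𝟙 (X ⊗ Y) := by
  cases X <;> cases Y <;>
    first | exact eq_of_zero _ _ | exact eq_of_top _ _ | skip
  case pos.pos A B => exact congrArg posHom (SymmetricCategory.symmetry A B)
  case pos.neg A T _ =>
    refine negHom_eq fun X => (map_op_comp₂ T (Iso.inv_hom_id (β_ A X.unop))).trans ?_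
    rw [op_id, T.map_id]
    rfl
  case neg.pos T _ A =>
    refine negHom_eq fun X => (map_op_comp₂ T (Iso.hom_inv_id (β_ A X.unop))).trans ?_
    rw [op_id, T.map_id]
    rfl

theorem braiding_naturality_right (X : Env.{t} C) {Y Z : Env.{t} C} (f : Y ⟶ Z) :
    X ◁ f ≫ (braiding X Z).hom = (braiding X Y).hom ≫ f ▷ X := by
  cases Y <;> cases Z <;> first | exact PEmpty.elim f | cases X <;>
    first | exact eq_of_zero _ _ | exact eq_of_top _ _ | skip
  case pos.pos.pos A => exact congrArg posHom (BraidedCategory.braiding_naturality_right A f.down)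
  case pos.pos.neg T _ =>
    exact negHom_eq fun X => map_op_comm T <| BraidedCategory.braiding_naturality_left f.down _
  case neg.neg.pos A =>
    exact negHom_eq fun X => f.down.naturality (β_ A X.unop).inv.op

theorem braiding_naturality_left {X Y : Env.{t} C} (f : X ⟶ Y) (Z : Env.{t} C) :
    f ▷ Z ≫ (braiding Y Z).hom = (braiding X Z).hom ≫ Z ◁ f := by
  have := braiding_naturality_right Z f
  rw [← cancel_mono (braiding Z Y).hom, Category.assoc, symmetry, Category.comp_id,
    Category.assoc, this, ← Category.assoc, symmetry, Category.id_comp]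

theorem hexagon_forward (X Y Z : Env.{t} C) :
    (α_ X Y Z).hom ≫ (braiding X (Y ⊗ Z)).hom ≫ (α_ Y Z X).hom =
      (braiding X Y).hom ▷ Z ≫ (α_ Y X Z).hom ≫ Y ◁ (braiding X Z).hom := by
  cases X <;> cases Y <;> cases Z <;>
    first | exact eq_of_zero _ _ | exact eq_of_top _ _ | skip
  case pos.pos.pos A B D => 
    refine congrArg posHom ?_
    exact BraidedCategory.hexagon_forward A B D
  case pos.pos.neg A B T _ =>
    refine negHom_eq fun X => map_op_comp₃₃ T ?_
    change (α_ X.unop A B).inv ≫ (β_ A X.unop).inv ▷ B ≫ (α_ A X.unop B).hom =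
      X.unop ◁ (β_ A B).hom ≫ (α_ X.unop B A).inv ≫ (β_ A (X.unop ⊗ B)).inv
    simp [← SymmetricCategory.braiding_swap_eq_inv_braiding,
      ← MonoidalCategory.whiskerLeft_comp_assoc]
  case pos.neg.pos A T _ D =>
    refine negHom_eq fun X => map_op_comp₃₃ T ?_
    change (α_ D X.unop A).hom ≫ D ◁ (β_ A X.unop).inv ≫ (α_ D A X.unop).inv =
      (β_ A (D ⊗ X.unop)).inv ≫ (α_ A D X.unop).inv ≫ (β_ A D).hom ▷ X.unop
    simp [← SymmetricCategory.braiding_swap_eq_inv_braiding,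
      ← MonoidalCategory.comp_whiskerRight]
  case neg.pos.pos T _ B D =>
    refine negHom_eq fun X => map_op_comp₃₃ T ?_
    change (α_ B D X.unop).inv ≫ (β_ (B ⊗ D) X.unop).hom ≫ (α_ X.unop B D).inv =
      (β_ B (D ⊗ X.unop)).hom ≫ (α_ D X.unop B).hom ≫ (β_ D (X.unop ⊗ B)).hom
    -- the two crossings of `B` and `D` on the right-hand side cancel by the symmetry of `C`
    have h := BraidedCategory.hexagon_forward D X.unop B
    rw [← Category.assoc, ← Iso.eq_comp_inv] at h
    rw [h]
    simp only [Category.assoc]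
    rw [← BraidedCategory.braiding_naturality_right_assoc]
    simp [← MonoidalCategory.whiskerLeft_comp_assoc]

instance : SymmetricCategory (Env.{t} C) where
  braiding := braiding
  braiding_naturality_right := braiding_naturality_right
  braiding_naturality_left := braiding_naturality_left
  hexagon_forward := hexagon_forward
  hexagon_reverse X Y Z := by
    -- by symmetry, this is the inverse of the first hexagon identity
    have inv_eq (V W : Env.{t} C) : (braiding V W).inv = (braiding W V).hom := by
      rw [← cancel_epi (braiding V W).hom, Iso.hom_inv_id]; exact (symmetry V W).symm
    have h : α_ Z X Y ≪≫ braiding Z (X ⊗ Y) ≪≫ α_ X Y Z =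
        whiskerRightIso (braiding Z X) Y ≪≫ α_ X Z Y ≪≫ whiskerLeftIso X (braiding Z Y) :=
      Iso.ext (hexagon_forward Z X Y)
    have := congrArg Iso.inv h
    simpa [inv_eq] using this
  symmetry := symmetry

/-! ### Duality in the envelope -/

/-- The dualizing object, the formal dual of the unit of `C`. -/
def bot : Env.{t} C := neg (yoneda.obj (𝟙_ C)) inferInstance

theorem isDualPairing_zero :
    IsDualPairing (show (zero : Env.{t} C) ⊗ top ⟶ bot from PUnit.unit) where
  right Y := ⟨fun _ _ _ => eq_of_top _ _, fun _ => ⟨by cases Y <;> exact PUnit.unit, rfl⟩⟩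
  left Y := by
    cases Y
    case zero => exact ⟨fun _ _ _ => rfl, fun _ => ⟨PUnit.unit, rfl⟩⟩
    all_goals exact ⟨fun f => PEmpty.elim f, fun g => PEmpty.elim g⟩

/-- The pairing of `A` with its formal dual: the natural transformation
`C(-, 𝟙) ⟶ C(- ⊗ A, A)` that corresponds under the Yoneda lemma to the left unitor. -/
def pairing (A : C) : (pos A : Env.{t} C) ⊗ neg (yoneda.obj A) inferInstance ⟶ bot :=
  negHom (S := rAct A (yoneda.obj A)) (yonedaEquiv.symm (show 𝟙_ C ⊗ A ⟶ A from (λ_ A).hom))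

/-- By the Yoneda lemma, a natural transformation `C(-, 𝟙) ⟶ T(- ⊗ A)` is an element of
`T(𝟙 ⊗ A) ≅ T(A)`, that is, a natural transformation `C(-, A) ⟶ T`, and a natural transformation
`C(-, 𝟙) ⟶ C(- ⊗ B, A)` is a morphism `B ⟶ A`. -/
theorem isDualPairing_pos (A : C) : IsDualPairing (pairing.{t} A) where
  right Y := by
    cases Y
    case zero => exact ⟨fun _ _ _ => rfl, fun _ => ⟨PUnit.unit, rfl⟩⟩
    case top => exact ⟨fun f => PEmpty.elim f, fun g => PEmpty.elim g⟩
    case pos => exact ⟨fun f => PEmpty.elim f, fun g => PEmpty.elim g⟩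
    case neg T hT =>
      let e : ((neg T hT : Env.{t} C) ⟶ neg (yoneda.obj A) inferInstance) ≃
          ((pos A : Env.{t} C) ⊗ neg T hT ⟶ bot) :=
        (Equiv.ulift.trans yonedaEquiv).trans <|
          (T.mapIso (λ_ A).op).toEquiv.trans <|
            (yonedaEquiv (F := rAct A T)).symm.trans Equiv.ulift.symm
      refine bijective_of_eq_equiv e fun f => ?_
      refine congrArg negHom (yonedaEquiv.injective ?_)
      change f.down.app (op (𝟙_ C ⊗ A)) (𝟙 (𝟙_ C) ▷ A ≫ (λ_ A).hom) =
        yonedaEquiv (X := 𝟙_ C) (F := rAct A T)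
          (yonedaEquiv.symm (T.map (λ_ A).hom.op (f.down.app (op A) (𝟙 A))))
      rw [Equiv.apply_symm_apply, ← NatTrans.naturality_apply]
      simp
  left Y := by
    cases Y
    case zero => exact ⟨fun _ _ _ => rfl, fun _ => ⟨PUnit.unit, rfl⟩⟩
    case top => exact ⟨fun f => PEmpty.elim f, fun g => PEmpty.elim g⟩
    case neg => exact ⟨fun f => PEmpty.elim f, fun g => PEmpty.elim g⟩
    case pos B =>
      let e : ((pos B : Env.{t} C) ⟶ pos A) ≃
          ((pos B : Env.{t} C) ⊗ neg (yoneda.obj A) inferInstance ⟶ bot) :=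
        Equiv.ulift.trans <| (λ_ B).symm.homFromEquiv.trans <|
            (yonedaEquiv (F := rAct B (yoneda.obj A))).symm.trans Equiv.ulift.symm
      refine bijective_of_eq_equiv e fun f => ?_
      refine congrArg negHom (yonedaEquiv.injective ?_)
      change 𝟙_ C ◁ f.down ≫ 𝟙 (𝟙_ C) ▷ A ≫ (λ_ A).hom =
        yonedaEquiv (X := 𝟙_ C) (F := rAct B (yoneda.obj A))
          (yonedaEquiv.symm (show 𝟙_ C ⊗ B ⟶ A from (λ_ B).hom ≫ f.down))
      rw [Equiv.apply_symm_apply]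
      simp

theorem exists_isDualPairing (X : Env.{t} C) :
    ∃ (X' : Env.{t} C) (p : X ⊗ X' ⟶ bot), IsDualPairing p := by
  cases X
  case zero => exact ⟨_, _, isDualPairing_zero⟩
  case top => exact ⟨_, _, isDualPairing_zero.symm⟩
  case pos A => exact ⟨_, _, isDualPairing_pos A⟩
  case neg T hT =>
    exact ⟨_, _, (isDualPairing_pos T.reprX).symm.ofIso (negIso (hS := hT) T.reprW)⟩

/-! ### The inclusion -/

/-- The inclusion of `C` into its envelope. -/
def incl : C ⥤ Env.{t} C where
  obj := pos
  map := posHom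
  map_id _ := rfl
  map_comp _ _ := rfl

instance : (incl : C ⥤ Env.{t} C).Full where
  map_surjective f := ⟨f.down, rfl⟩

instance : (incl : C ⥤ Env.{t} C).Faithful where
  map_injective h := congrArg ULift.down h

/-- The inclusion is strict monoidal. -/
def inclCoreMonoidal : (incl : C ⥤ Env.{t} C).CoreMonoidal where
  εIso := Iso.refl _
  μIso _ _ := Iso.refl _
  μIso_hom_natural_left f A := (Category.comp_id _).trans (Category.id_comp _).symm
  μIso_hom_natural_right A f := (Category.comp_id _).trans (Category.id_comp _).symm
  associativity A B D := congrArg posHom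
    (show 𝟙 (A ⊗ B) ▷ D ≫ 𝟙 _ ≫ (α_ A B D).hom = (α_ A B D).hom ≫ A ◁ 𝟙 (B ⊗ D) ≫ 𝟙 _ by simp)
  left_unitality A := congrArg posHom
    (show (λ_ A).hom = 𝟙 (𝟙_ C) ▷ A ≫ 𝟙 _ ≫ (λ_ A).hom by simp)
  right_unitality A := congrArg posHom
    (show (ρ_ A).hom = A ◁ 𝟙 (𝟙_ C) ≫ 𝟙 _ ≫ (ρ_ A).hom by simp)

instance : (incl : C ⥤ Env.{t} C).Monoidal := inclCoreMonoidal.toMonoidal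

instance : (incl : C ⥤ Env.{t} C).Braided where
  braided _ _ := (Category.id_comp _).trans (Category.comp_id _).symm

/-- The comparison map is tested on morphisms out of an object `W`. If `W` is positive, both sides
are computed in `C`; otherwise both are unique or do not exist. -/
theorem preservesInternalHom_incl [MonoidalClosed (Env.{t} C)] :
    ClosedSMC.PreservesInternalHom (incl : C ⥤ Env.{t} C) := fun A B => by
  refine isIso_of_yoneda_bijective _ fun W => ?_
  refine (Function.Bijective.of_comp_iff' (uncurry_bijective (pos A) (pos B) W) _).1 ?_
  cases W
  case zero => exact ⟨fun _ _ _ => rfl, fun _ => ⟨PUnit.unit, rfl⟩⟩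
  case top => exact ⟨fun f => PEmpty.elim f, fun g => PEmpty.elim g⟩
  case neg => exact ⟨fun f => PEmpty.elim f, fun g => PEmpty.elim g⟩
  case pos D =>
    let e : ((pos D : Env.{t} C) ⟶ pos ((ihom A).obj B)) ≃ ((pos A : Env.{t} C) ⊗ pos D ⟶ pos B) :=
      (Equiv.ulift.trans (Equiv.ofBijective _ (uncurry_bijective A B D))).trans Equiv.ulift.symm
    refine bijective_of_eq_equiv e fun f => ?_
    have h : MonoidalClosed.uncurry (ClosedSMC.ihomComparison (incl : C ⥤ Env.{t} C) A B) =
        posHom ((ihom.ev A).app B) :=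
      (MonoidalClosed.uncurry_curry _).trans (Category.id_comp _)
    exact (MonoidalClosed.uncurry_natural_left f _).trans (congrArg _ h)

variable {J : Type*} [Category* J] [Nonempty J]

/-- A cone over a nonempty diagram in `C` has as its vertex either an object of `C` or `zero`:
a negative vertex or the vertex `top` admits no morphism to an object of the diagram. -/
instance preservesLimit_incl (K : J ⥤ C) : PreservesLimit K (incl : C ⥤ Env.{t} C) where
  preserves {c} hc := by
    refine ⟨IsLimit.ofExistsUnique fun s => ?_⟩
    obtain ⟨X, π⟩ := s
    have j₀ : J := Classical.arbitrary J
    cases X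
    case zero => exact ⟨PUnit.unit, fun _ => rfl, fun _ _ => rfl⟩
    case top => exact PEmpty.elim (π.app j₀)
    case neg => exact PEmpty.elim (π.app j₀)
    case pos A =>
      let s : Cone K :=
        { pt := A
          π :=
            { app := fun j => (π.app j).down
              naturality := fun i j f => congrArg ULift.down (π.naturality f) } }
      exact ⟨posHom (hc.lift s), fun j => congrArg posHom (hc.fac s j), fun m hm =>
        congrArg posHom (hc.uniq s m.down fun j => congrArg ULift.down (hm j))⟩

instance preservesColimit_incl (K : J ⥤ C) : PreservesColimit K (incl : C ⥤ Env.{t} C) where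
  preserves {c} hc := by
    refine ⟨IsColimit.ofExistsUnique fun s => ?_⟩
    obtain ⟨X, ι⟩ := s
    have j₀ : J := Classical.arbitrary J
    cases X
    case top => exact ⟨PUnit.unit, fun _ => rfl, fun _ _ => rfl⟩
    case zero => exact PEmpty.elim (ι.app j₀)
    case neg => exact PEmpty.elim (ι.app j₀)
    case pos A =>
      let s : Cocone K :=
        { pt := A
          ι :=
            { app := fun j => (ι.app j).down
              naturality := fun i j f => congrArg ULift.down (ι.naturality f) } }
      exact ⟨posHom (hc.desc s), fun j => congrArg posHom (hc.fac s j), fun m hm =>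
        congrArg posHom (hc.uniq s m.down fun j => congrArg ULift.down (hm j))⟩

end Env

end Monoidal
end StarEnvelope

theorem mainTheorem3
    (C : Type u) [Category.{v} C] [MonoidalCategory C] [SymmetricCategory C] [MonoidalClosed C]
    -- a family of nonempty diagrams that have a limit in `C`
    (I : Type w) (J : I → Type w₁) [∀ i, Category.{w₂} (J i)] [∀ i, Nonempty (J i)]
    (K : ∀ i, J i ⥤ C) [∀ i, HasLimit (K i)]
    -- a family of nonempty diagrams that have a colimit in `C`
    (I' : Type w) (J' : I' → Type w₁) [∀ i, Category.{w₂} (J' i)] [∀ i, Nonempty (J' i)]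
    (K' : ∀ i, J' i ⥤ C) [∀ i, HasColimit (K' i)] :
    ∃ (D : Type (max u v w w₁ w₂ + 1)) (_ : Category.{max u v w w₁ w₂} D)
      (_ : MonoidalCategory D) (_ : SymmetricCategory D) (_ : MonoidalClosed D)
      (_ : ClosedSMC.StarAutonomous D) (F : C ⥤ D) (_ : F.Braided),
      F.Full ∧ F.Faithful ∧ ClosedSMC.PreservesInternalHom F ∧
        (∀ i, PreservesLimit (K i) F) ∧ (∀ i, PreservesColimit (K' i) F) := by
  choose d p hp using StarEnvelope.Env.exists_isDualPairing.{max w w₁ w₂} (C := C)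
  let clo : MonoidalClosed (StarEnvelope.Env.{max w w₁ w₂} C) :=
    StarEnvelope.monoidalClosedOfDual hp
  exact ⟨StarEnvelope.Env.{max w w₁ w₂} C, inferInstance, inferInstance, inferInstance, clo,
    ⟨StarEnvelope.Env.bot, fun X => StarEnvelope.isIso_toDoubleDual (hp X)⟩,
    StarEnvelope.Env.incl, inferInstance, inferInstance, inferInstance,
    StarEnvelope.Env.preservesInternalHom_incl, fun _ => inferInstance, fun _ => inferInstance⟩
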